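/- **Setting.** Let $\|\cdot\|_2$ be the Euclidean (for matrices: spectral) norm and $\mathbf D_2(x,y)=\|x-y\|_2^2/2$. A function $\psi:\mathbb R^k\to\mathbb R$ is *directionally differentiable* if $\delta\psi(x;h)=\lim_{t\to0+}\{\psi(x+th)-\psi(x)\}/t$ exists and is finite for all $x,h$; then $\Delta_\psi(x,y)=\psi(x)-\psi(y)-\delta\psi(y;x-y)$. A *thresholding function* $\Theta(t;\lambda)$ ($t\in\mathbb R$, $\lambda\ge0$) is odd and nondecreasing in $t$, tends to $\infty$ as $t\to\infty$, and satisfies $0\le\Theta(t;\lambda)\le t$ for $t\ge0$. Put $\Theta^{-1}(u;\lambda)=\sup\{t:\Theta(t;\lambda)\le u\}$, $\mathcal L_\Theta=1-\operatorname{ess\,inf}_{u\ge0}\,\mathrm d\Theta^{-1}(u;\lambda)/\mathrm du$, $P_\Theta(t;\lambda)=\int_0^{|t|}(\Theta^{-1}(u;\lambda)-u)\,\mathrm du$, and $P_H(t;\lambda)=(-t^2/2+\lambda|t|)1_{|t|<\lambda}+(\lambda^2/2)1_{|t|\ge\lambda}$; for vectors, $P(\beta;\lambda)=\sum_jP(\beta_j;\lambda)$.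 Let $J(\beta)$ be the number of nonzero entries of $\beta$. Let $X\in\mathbb R^{n\times p}$ and $\beta^*\in\mathbb R^p$ be fixed, let $l_0:\mathbb R^n\to\mathbb R$ be a random (data-dependent) directionally differentiable loss that is differentiable at $X\beta^*$, and put $l(\beta)=l_0(X\beta)$. Assume that $\epsilon=-\nabla l_0(X\beta^*)$ is a sub-Gaussian random vector with mean zero and scale bounded by $\sigma>0$, i.e. each $\langle\epsilon,v\rangle$ is sub-Gaussian with $\inf\{s>0:\mathbb E\exp(\langle\epsilon,v\rangle^2/s^2)\le2\}\le\sigma\|v\|_2$. Let $\varrho\ge\|X\|_2$, let $\psi$ be a (possibly random) directionally differentiable function on $\mathbb R^p$, and let $\hat\beta$ be any (random) fixed point of the surrogate $g(\beta;\beta^-)=l(\beta)+P_\Theta(\varrho\beta;\lambda)+\Delta_\psi(\beta,\beta^-)$, that is, $\hat\beta\in\arg\min_\beta g(\beta;\hat\beta)$. Let $-\infty\le\alpha\le L\le+\infty$ be such that, for some pseudo-metric $d$ on $\mathbb R^n$ (nonnegative, symmetric, with the triangle inequality), $\alpha d^2(\eta,\eta')\le\Delta_{l_0}(\eta,\eta')\le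 Ld^2(\eta,\eta')$ for all $\eta,\eta'$. **Theorem.** There exist universal constants $A_0,C>0$ such that the following holds whenever $A\ge A_0$. Let $\beta\in\mathbb R^p$, $0\le r<1$ with $0\le\alpha r/L<\infty$ (where $\alpha r/L$ is read as $0$ if $r=0$ or the quotient is undefined, i.e. $L=0$ or $\alpha,L$ are both infinite), $\delta>0$, $\vartheta>0$, $K\ge0$, and $\lambda=A\sigma\sqrt{\log(ep)}\big/\sqrt{(\delta\wedge2\vartheta)\vartheta}$. Assume that $\Delta_l(\beta,\beta^*)$ is integrable, that $\mathbb E\,\Delta_l(\beta,\beta^*)\ge0$ in case $r>0$ (automatic if $\alpha\ge0$), and that, almost surely, for all $\gamma\in\mathbb R^p$, $$\varrho^2\mathcal L_\Theta\mathbf D_2(\beta,\gamma)+\delta\mathbf D_2(X\beta,X\gamma)+\vartheta P_H(\varrho(\beta-\gamma);\lambda)+P_\Theta(\varrho\beta;\lambda)\le\Big(1+\frac{\alpha}{L}r\Big)\Delta_l(\beta,\gamma)+P_\Theta(\varrho\gamma;\lambda)+K\lambda^2J(\beta).$$ Then the positive part of $\Delta_l(\hat\beta,\beta^*)$ is integrable,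 and (the left-hand side possibly being $-\infty$) $$\mathbb E\,\Delta_l(\hat\beta,\beta^*)\le\mathbb E\Big\{\Big(\frac{1+r}{1-r}\Big)^2\Delta_l(\beta,\beta^*)+\frac{(1+r)KA^2}{(1-r)(2\vartheta\wedge\delta)\vartheta}\,\sigma^2J(\beta)\log(ep)\Big\}+\frac{C(1+r)}{(1-r)(2\vartheta\wedge\delta)}\,\sigma^2.$$ With $r=0$ this is a sharp oracle inequality (leading constant $1$). -/

import Mathlib

open MeasureTheory Filter Topology

namespace OracleIneq

noncomputable section

/-- Euclidean space of dimension `k`. -/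
abbrev Vec (k : ℕ) : Type := EuclideanSpace ℝ (Fin k)

/-- The linear map `β ↦ X β` between Euclidean spaces given by a design matrix `X`. Its operator
norm is the spectral norm of `X`. -/
def designMap {n p : ℕ} (X : Matrix (Fin n) (Fin p) ℝ) : Vec p →L[ℝ] Vec n :=
  LinearMap.toContinuousLinearMap (Matrix.toEuclideanLin X)

/-! ### One-sided directional derivatives and generalized Bregman functions -/

/-- One-sided directional derivative `lim_{t → 0+} (ψ (x + t h) - ψ x) / t`. -/
def dirDeriv {k : ℕ} (ψ : Vec k → ℝ) (x h : Vec k) : ℝ :=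
  derivWithin (fun t : ℝ => ψ (x + t • h)) (Set.Ici 0) 0

/-- The one-sided directional derivatives of `ψ` exist and are finite, at every point and in
every direction. -/
def DirDifferentiable {k : ℕ} (ψ : Vec k → ℝ) : Prop :=
  ∀ x h : Vec k, DifferentiableWithinAt ℝ (fun t : ℝ => ψ (x + t • h)) (Set.Ici 0) 0

/-- Generalized Bregman function `ψ x - ψ y - δψ(y; x - y)`. -/
def gbf {k : ℕ} (ψ : Vec k → ℝ) (x y : Vec k) : ℝ :=
  ψ x - ψ y - dirDeriv ψ y (x - y)

/-- The generalized Bregman function of `‖·‖² / 2`. -/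
def D2 {k : ℕ} (x y : Vec k) : ℝ := ‖x - y‖ ^ 2 / 2

/-- A pseudo-metric: nonnegative, symmetric, with the triangle inequality. -/
structure IsPseudoMetric {T : Type*} (d : T → T → ℝ) : Prop where
  nonneg : ∀ x y, 0 ≤ d x y
  symm : ∀ x y, d x y = d y x
  triangle : ∀ x y z, d x y ≤ d x z + d y z

/-! ### Thresholding functions and the penalties they induce -/

/-- Thresholding function `Θ(t; lam)`, for real `t` and `lam ≥ 0`. -/
structure IsThresholding (Θ : ℝ → ℝ → ℝ) : Prop where
  odd : ∀ lam, 0 ≤ lam → ∀ t, Θ (-t) lam = -Θ t lam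
  mono : ∀ lam, 0 ≤ lam → ∀ t t', t ≤ t' → Θ t lam ≤ Θ t' lam
  tendsto : ∀ lam, 0 ≤ lam → Tendsto (fun t => Θ t lam) atTop atTop
  nonneg : ∀ lam, 0 ≤ lam → ∀ t, 0 ≤ t → 0 ≤ Θ t lam
  le_self : ∀ lam, 0 ≤ lam → ∀ t, 0 ≤ t → Θ t lam ≤ t

/-- Generalized inverse `Θ⁻¹(u; lam) = sup {t : Θ(t; lam) ≤ u}`. -/
def thetaInv (Θ : ℝ → ℝ → ℝ) (lam u : ℝ) : ℝ := sSup {t : ℝ | Θ t lam ≤ u}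

/-- Concavity number `1 - ess inf {dΘ⁻¹(u; lam)/du : u ≥ 0}`. -/
def concavityNumber (Θ : ℝ → ℝ → ℝ) (lam : ℝ) : ℝ :=
  1 - essInf (fun u : ℝ => deriv (thetaInv Θ lam) u) (volume.restrict (Set.Ici (0 : ℝ)))

/-- The univariate penalty induced by `Θ`: `∫₀^|t| (Θ⁻¹(u; lam) - u) du`. -/
def thetaPen (Θ : ℝ → ℝ → ℝ) (lam t : ℝ) : ℝ :=
  ∫ u in (0 : ℝ)..|t|, (thetaInv Θ lam u - u)

/-- The univariate hard-thresholding penalty. -/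
def hardPen (lam t : ℝ) : ℝ :=
  if |t| < lam then -t ^ 2 / 2 + lam * |t| else lam ^ 2 / 2

/-- Separable extension of a univariate penalty to vectors. -/
def sepPen {p : ℕ} (P : ℝ → ℝ) (β : Vec p) : ℝ := ∑ j, P (β j)

/-- Cardinality of the support of `β`. -/
def suppCard {p : ℕ} (β : Vec p) : ℕ := (Finset.univ.filter (fun j => β j ≠ 0)).card

/-! ### Loss, surrogate, and its fixed points -/

/-- The loss as a function of the coefficients, `l(β) = l₀(X β)`. -/
def lossOf {n p : ℕ} (l₀ : Vec n → ℝ) (X : Matrix (Fin n) (Fin p) ℝ) (β : Vec p) : ℝ :=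
  l₀ (designMap X β)

/-- Generalized Bregman surrogate
`g(β; β⁻) = l(β) + P_Θ(ϱ β; lam) + Δ_ψ(β, β⁻)`. -/
def surrogate {n p : ℕ} (l₀ : Vec n → ℝ) (X : Matrix (Fin n) (Fin p) ℝ) (Θ : ℝ → ℝ → ℝ)
    (ϱ lam : ℝ) (ψ : Vec p → ℝ) (β βm : Vec p) : ℝ :=
  lossOf l₀ X β + sepPen (thetaPen Θ lam) (ϱ • β) + gbf ψ β βm

/-- `b` is a fixed point of the surrogate `g`: `b ∈ argmin_β g(β; b)`. -/
def IsFixedPt {p : ℕ} (g : Vec p → Vec p → ℝ) (b : Vec p) : Prop :=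
  ∀ β : Vec p, g b b ≤ g β b

/-- Effective noise `-∇l₀(X β*)`. -/
def effectiveNoise {n p : ℕ} (l₀ : Vec n → ℝ) (X : Matrix (Fin n) (Fin p) ℝ) (βs : Vec p) :
    Vec n :=
  -gradient l₀ (designMap X βs)

/-! ### Sub-Gaussian random vectors and expectations -/

/-- A real random variable with a sub-Gaussian tail. -/
def IsSubGaussianVar {Ω : Type*} [MeasurableSpace Ω] (μ : Measure Ω) (ξ : Ω → ℝ) : Prop :=
  ∃ C c : ℝ, 0 < C ∧ 0 < c ∧
    ∀ t : ℝ, 0 < t → μ {ω | t ≤ |ξ ω|} ≤ ENNReal.ofReal (C * Real.exp (-c * t ^ 2))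

/-- The scale (ψ₂-norm) `inf {s > 0 : E exp(ξ² / s²) ≤ 2}`, which is `∞` if there is no such
`s`. -/
def psi2Norm {Ω : Type*} [MeasurableSpace Ω] (μ : Measure Ω) (ξ : Ω → ℝ) : ENNReal :=
  sInf {a : ENNReal | ∃ s : ℝ, 0 < s ∧ a = ENNReal.ofReal s ∧
    ∫⁻ ω, ENNReal.ofReal (Real.exp (ξ ω ^ 2 / s ^ 2)) ∂μ ≤ 2}

/-- A sub-Gaussian random vector with scale bounded by `σ`. -/
structure IsSubGaussianVec {Ω : Type*} [MeasurableSpace Ω] (μ : Measure Ω) {n : ℕ}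
    (ξ : Ω → Vec n) (σ : ℝ) : Prop where
  aemeasurable : AEMeasurable ξ μ
  marginal : ∀ v : Vec n, IsSubGaussianVar μ (fun ω => inner ℝ (ξ ω) v)
  scale : ∀ v : Vec n, psi2Norm μ (fun ω => inner ℝ (ξ ω) v) ≤ ENNReal.ofReal (σ * ‖v‖)

/-- Extended-real expectation `E f⁺ - E f⁻`, meaningful as soon as one of the two terms is
finite. -/
def extExpectation {Ω : Type*} [MeasurableSpace Ω] (μ : Measure Ω) (f : Ω → ℝ) : EReal :=
  ((∫⁻ ω, ENNReal.ofReal (f ω) ∂μ : ENNReal) : EReal)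
    - ((∫⁻ ω, ENNReal.ofReal (-f ω) ∂μ : ENNReal) : EReal)

/-- The regularity condition at the reference point `β`, for one realization `l₀` of the loss;
`q` stands for the ratio `α r / L`. -/
def RegularityCondition {n p : ℕ} (l₀ : Vec n → ℝ) (X : Matrix (Fin n) (Fin p) ℝ)
    (Θ : ℝ → ℝ → ℝ) (ϱ lam q δ ϑ K : ℝ) (β : Vec p) : Prop :=
  ∀ γ : Vec p,
    ϱ ^ 2 * concavityNumber Θ lam * D2 β γ + δ * D2 (designMap X β) (designMap X γ)
        + ϑ * sepPen (hardPen lam) (ϱ • (β - γ)) + sepPen (thetaPen Θ lam) (ϱ • β)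
      ≤ (1 + q) * gbf (lossOf l₀ X) β γ + sepPen (thetaPen Θ lam) (ϱ • γ)
        + K * lam ^ 2 * (suppCard β : ℝ)

end

end OracleIneq

/-! A fixed point `b` obeys a first-order condition toward `β`: the directional derivative of
`Δ_ψ(·, b)` at `b` vanishes, and `P_Θ` becomes convex after adding `L_Θ t²/2`. Adding the regularity
condition at `γ = b` cancels the penalty and concavity terms and leaves (`gbf_le_of_isFixedPt`)
`Δ(b,β*) ≤ Δ(β,β*) + q Δ(β,b) + Kλ²J(β) + N(b - β)`, where `N(h) = ⟨ε,Xh⟩ - (c/2)‖Xh‖² - ϑ P_H(ϱh)`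
and `c = δ ∧ ϑ`.

The noise term is bounded uniformly in `h`. Since `‖X‖ ≤ ϱ` and `c ≤ ϑ`, `N` is convex in each
coordinate between 0 and `±λ/ϱ`, so every nonzero coordinate may be assumed to have `|ϱh_j| ≥ λ`
(`exists_sparse_noiseObj_le`). Then `P_H` counts the support `S`, and completing the square leaves
`‖Π_S ε‖²/(2c) - ϑλ²|S|/2`, with `Π_S` the projection onto the span of the columns in `S`.
Exponential moments of `‖Π_S ε‖²`, obtained by Gaussian linearization, are summed over all `S`; the
choice of `λ` keeps the sum bounded (`lintegral_noiseBound_le`).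

The term `q Δ(β,b)` is absorbed by the curvature bounds and the triangle inequality for `d`
(`exists_ae_le_of_curvature`), which produces the factors `(1+r)/(1-r)`. Integration finishes the
proof. -/

namespace OracleIneq

/-! ### The penalty induced by a thresholding function -/

section Penalty

variable {Θ : ℝ → ℝ → ℝ} {lam : ℝ}

/-- `sSup` takes a default value on empty or unbounded sets; with `nonempty` below, this makes
`thetaInv` a genuine supremum. -/
theorem IsThresholding.bddAbove (hΘ : IsThresholding Θ) (hl : 0 ≤ lam) (u : ℝ) :
    BddAbove {t : ℝ | Θ t lam ≤ u} := by
  obtain ⟨T, hT⟩ := ((hΘ.tendsto lam hl).eventually_gt_atTop u).exists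
  refine ⟨T, fun t ht => ?_⟩
  by_contra! h
  exact absurd (hΘ.mono lam hl _ _ h.le) (not_le.2 (lt_of_le_of_lt ht hT))

theorem IsThresholding.nonempty (hΘ : IsThresholding Θ) (hl : 0 ≤ lam) (u : ℝ) :
    {t : ℝ | Θ t lam ≤ u}.Nonempty := by
  obtain ⟨T, hT⟩ := ((hΘ.tendsto lam hl).eventually_ge_atTop (-u)).exists
  refine ⟨-T, ?_⟩
  simp only [Set.mem_ofPred_eq, hΘ.odd lam hl]
  linarith

theorem IsThresholding.monotone_thetaInv (hΘ : IsThresholding Θ) (hl : 0 ≤ lam) :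
    Monotone (thetaInv Θ lam) := fun u v huv =>
  csSup_le_csSup (hΘ.bddAbove hl v) (hΘ.nonempty hl u) fun _ ht => le_trans ht huv

theorem IsThresholding.thetaInv_zero_nonneg (hΘ : IsThresholding Θ) (hl : 0 ≤ lam) :
    0 ≤ thetaInv Θ lam 0 :=
  le_csSup (hΘ.bddAbove hl 0) (hΘ.le_self lam hl 0 le_rfl)

/-- After subtracting its minimal slope, the generalized inverse is still nondecreasing. -/
theorem IsThresholding.monotoneOn_thetaInv_sub (hΘ : IsThresholding Θ) (hl : 0 ≤ lam) :
    MonotoneOn (fun u => thetaInv Θ lam u - (1 - concavityNumber Θ lam) * u) (Set.Ici 0) := by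
  have hmono := hΘ.monotone_thetaInv hl
  have hm : ∀ᵐ u ∂(volume.restrict (Set.Ici (0 : ℝ))),
      1 - concavityNumber Θ lam ≤ deriv (thetaInv Θ lam) u := by
    simp only [concavityNumber, sub_sub_cancel]
    exact ae_essInf_le (isBoundedUnder_of_eventually_ge (a := 0)
      (.of_forall fun u => hmono.deriv_nonneg))
  intro x hx y hy hxy
  have hint := (hmono.monotoneOn (Set.uIcc x y)).intervalIntegrable_deriv
  -- The integral of the a.e. derivative of a monotone function is at most its increment: jumps and
  -- singular parts only help.
  have h1 := (hmono.monotoneOn (Set.uIcc x y)).intervalIntegral_deriv_mem_uIcc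
  rw [Set.uIcc_of_le (sub_nonneg.2 (hmono hxy))] at h1
  have h2 : ∫ _ in x..y, (1 - concavityNumber Θ lam) ≤ ∫ u in x..y, deriv (thetaInv Θ lam) u := by
    apply intervalIntegral.integral_mono_ae_restrict hxy (by simp) hint
    exact ae_restrict_of_ae_restrict_of_subset (fun z hz => le_trans hx hz.1) hm
  rw [intervalIntegral.integral_const, smul_eq_mul] at h2
  have := h1.2
  simp only
  linarith

/-- A subgradient inequality for the primitive of a nondecreasing function. -/
theorem integral_ge_of_monotoneOn {φ : ℝ → ℝ} (hφ : MonotoneOn φ (Set.Ici 0)) {x y : ℝ}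
    (hx : 0 ≤ x) (hy : 0 ≤ y) :
    φ x * (y - x) ≤ (∫ u in (0 : ℝ)..y, φ u) - ∫ u in (0 : ℝ)..x, φ u := by
  have hI : ∀ a b : ℝ, 0 ≤ a → 0 ≤ b → IntervalIntegrable φ volume a b := fun a b ha hb =>
    (hφ.mono fun z hz => le_trans (le_min ha hb) hz.1).intervalIntegrable
  rw [intervalIntegral.integral_interval_sub_left (hI 0 y le_rfl hy) (hI 0 x le_rfl hx)]
  rcases le_total x y with h | h
  · have := intervalIntegral.integral_mono_on h (f := fun _ => φ x) (by simp) (hI x y hx hy)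
      fun u hu => hφ hx (le_trans hx hu.1) hu.1
    simp only [intervalIntegral.integral_const, smul_eq_mul] at this
    linarith
  · have := intervalIntegral.integral_mono_on h (g := fun _ => φ x) (hI y x hy hx) (by simp)
      fun u hu => hφ (le_trans hy hu.1) hx hu.2
    simp only [intervalIntegral.integral_const, smul_eq_mul] at this
    rw [intervalIntegral.integral_symm]
    linarith

/-- The quadratic correction turns the integrand into the nondecreasing function of
`monotoneOn_thetaInv_sub`, so the sum is a convex function of `|t|`. -/
theorem IsThresholding.thetaPen_add_eq (hΘ : IsThresholding Θ) (hl : 0 ≤ lam) (t : ℝ) :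
    thetaPen Θ lam t + concavityNumber Θ lam * t ^ 2 / 2
      = ∫ u in (0 : ℝ)..|t|, (thetaInv Θ lam u - (1 - concavityNumber Θ lam) * u) := by
  have hI : IntervalIntegrable (thetaInv Θ lam) volume 0 |t| :=
    (hΘ.monotone_thetaInv hl).intervalIntegrable
  rw [thetaPen, intervalIntegral.integral_sub hI (Continuous.intervalIntegrable (by fun_prop) _ _),
    intervalIntegral.integral_sub hI (Continuous.intervalIntegrable (by fun_prop) _ _),
    intervalIntegral.integral_const_mul, integral_id, sq_abs]
  ring

/-- The induced penalty is convex up to the quadratic given by the concavity number. -/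
theorem IsThresholding.thetaPen_segment_le (hΘ : IsThresholding Θ) (hl : 0 ≤ lam) (x y : ℝ)
    {t : ℝ} (ht0 : 0 ≤ t) (ht1 : t ≤ 1) :
    thetaPen Θ lam ((1 - t) * x + t * y) ≤ (1 - t) * thetaPen Θ lam x + t * thetaPen Θ lam y
      + concavityNumber Θ lam * (t * (1 - t) * (x - y) ^ 2 / 2) := by
  set z := (1 - t) * x + t * y with hz
  set φ : ℝ → ℝ := fun u => thetaInv Θ lam u - (1 - concavityNumber Θ lam) * u with hφdef
  have hφ : MonotoneOn φ (Set.Ici 0) := hΘ.monotoneOn_thetaInv_sub hl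
  -- A nonnegative slope at `|z|` makes the loss in `|z| ≤ (1-t)|x| + t|y|` harmless.
  have hφz : 0 ≤ φ |z| := by
    have h0 : 0 ≤ φ 0 := by simpa [hφdef] using hΘ.thetaInv_zero_nonneg hl
    exact h0.trans (hφ (by simp) (abs_nonneg z) (abs_nonneg z))
  have hx := integral_ge_of_monotoneOn hφ (abs_nonneg z) (abs_nonneg x)
  have hy := integral_ge_of_monotoneOn hφ (abs_nonneg z) (abs_nonneg y)
  have hzle : |z| ≤ (1 - t) * |x| + t * |y| := by
    refine (abs_add_le _ _).trans_eq ?_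
    rw [abs_mul, abs_mul, abs_of_nonneg ht0, abs_of_nonneg (sub_nonneg.2 ht1)]
  simp only [hφdef] at hx hy
  rw [← hΘ.thetaPen_add_eq hl, ← hΘ.thetaPen_add_eq hl] at hx hy
  have h1 := mul_le_mul_of_nonneg_left hx (sub_nonneg.2 ht1)
  have h2 := mul_le_mul_of_nonneg_left hy ht0
  have h3 := mul_nonneg hφz (sub_nonneg.2 hzle)
  simp only [hφdef] at h3
  have h4 : (1 - t) * x ^ 2 + t * y ^ 2 - z ^ 2 = t * (1 - t) * (x - y) ^ 2 := by rw [hz]; ring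
  linear_combination h1 + h2 + h3 + concavityNumber Θ lam / 2 * h4

end Penalty

/-! ### Exponential moments of quadratic forms of sub-Gaussian vectors -/

section SubGaussian

open ProbabilityTheory

/-- The infimum defining the scale need not be attained, so some `s < 2σ‖v‖` is used; then `x ≤
x²/s² + s²/4 ≤ x²/s² + σ²‖v‖²`. -/
theorem IsSubGaussianVec.lintegral_exp_inner_le {Ω : Type*} [MeasurableSpace Ω] {μ : Measure Ω}
    [IsProbabilityMeasure μ] {n : ℕ} {ξ : Ω → Vec n} {σ : ℝ} (h : IsSubGaussianVec μ ξ σ)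
    (hσ : 0 < σ) (v : Vec n) :
    ∫⁻ ω, ENNReal.ofReal (Real.exp (inner ℝ (ξ ω) v)) ∂μ
      ≤ 2 * ENNReal.ofReal (Real.exp (σ ^ 2 * ‖v‖ ^ 2)) := by
  rcases eq_or_ne v 0 with rfl | hv
  · simp
  have hpos : 0 < σ * ‖v‖ := mul_pos hσ (norm_pos_iff.2 hv)
  have hlt : psi2Norm μ (fun ω => inner ℝ (ξ ω) v) < ENNReal.ofReal (2 * (σ * ‖v‖)) :=
    (h.scale v).trans_lt ((ENNReal.ofReal_lt_ofReal_iff (by positivity)).2 (by linarith))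
  obtain ⟨_, ⟨s, hs, rfl, hint⟩, hlt⟩ := sInf_lt_iff.1 hlt
  have hs' : s < 2 * (σ * ‖v‖) := (ENNReal.ofReal_lt_ofReal_iff (by positivity)).1 hlt
  have hpt : ∀ x : ℝ, Real.exp x ≤ Real.exp (x ^ 2 / s ^ 2) * Real.exp (σ ^ 2 * ‖v‖ ^ 2) := by
    intro x
    rw [← Real.exp_add, Real.exp_le_exp]
    have h1 : x ≤ x ^ 2 / s ^ 2 + s ^ 2 / 4 := by
      have h2 : x ^ 2 / s ^ 2 + s ^ 2 / 4 - x = (x / s - s / 2) ^ 2 := by field_simp; ring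
      linarith [sq_nonneg (x / s - s / 2)]
    have h3 : s ^ 2 ≤ (2 * (σ * ‖v‖)) ^ 2 := pow_le_pow_left₀ hs.le hs'.le 2
    nlinarith
  calc ∫⁻ ω, ENNReal.ofReal (Real.exp (inner ℝ (ξ ω) v)) ∂μ
      ≤ ∫⁻ ω, ENNReal.ofReal (Real.exp (inner ℝ (ξ ω) v ^ 2 / s ^ 2))
          * ENNReal.ofReal (Real.exp (σ ^ 2 * ‖v‖ ^ 2)) ∂μ := by
        refine lintegral_mono fun ω => ?_
        rw [← ENNReal.ofReal_mul (Real.exp_nonneg _)]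
        exact ENNReal.ofReal_le_ofReal (hpt _)
    _ ≤ _ := by
        rw [lintegral_mul_const' _ _ ENNReal.ofReal_ne_top]
        gcongr

theorem lintegral_ofReal_prod_eq {k : ℕ} {ν : Measure ℝ} [SigmaFinite ν] {f : Fin k → ℝ → ℝ}
    (hf : ∀ i, Integrable (f i) ν) (hf0 : ∀ i x, 0 ≤ f i x) :
    ∫⁻ x, ENNReal.ofReal (∏ i, f i (x i)) ∂(Measure.pi fun _ : Fin k => ν)
      = ∏ i, ∫⁻ x, ENNReal.ofReal (f i x) ∂ν := by
  rw [← ofReal_integral_eq_lintegral_ofReal (Integrable.fintype_prod hf)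
      (.of_forall fun x => Finset.prod_nonneg fun i _ => hf0 i _),
    integral_fintype_prod_eq_prod, ENNReal.ofReal_prod_of_nonneg
      fun i _ => integral_nonneg (hf0 i)]
  exact Finset.prod_congr rfl fun i _ =>
    ofReal_integral_eq_lintegral_ofReal (hf i) (.of_forall (hf0 i))

theorem integral_exp_mul_gaussian (t : ℝ) :
    ∫ x, Real.exp (t * x) ∂gaussianReal 0 1 = Real.exp (t ^ 2 / 2) := by
  have := congrFun (mgf_id_gaussianReal (μ := 0) (v := 1)) t
  simpa [mgf] using this

theorem gaussianPDFReal_smul_exp_sq (x : ℝ) :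
    gaussianPDFReal 0 1 x • Real.exp (x ^ 2 / 4)
      = (√(2 * Real.pi))⁻¹ * Real.exp (-(1 / 4) * x ^ 2) := by
  rw [gaussianPDFReal, smul_eq_mul, mul_assoc, ← Real.exp_add]
  simp only [NNReal.coe_one, mul_one, sub_zero]
  congr 2
  ring

theorem integrable_exp_sq_gaussian :
    Integrable (fun x : ℝ => Real.exp (x ^ 2 / 4)) (gaussianReal 0 1) := by
  rw [gaussianReal_of_var_ne_zero _ one_ne_zero,
    integrable_withDensity_iff_integrable_smul₀' (by fun_prop) (by simp [gaussianPDF_lt_top])]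
  simp only [toReal_gaussianPDF, gaussianPDFReal_smul_exp_sq]
  exact (integrable_exp_neg_mul_sq (by norm_num)).const_mul _

/-- The exact value is `√2`; the cruder 2 suffices. -/
theorem lintegral_exp_sq_gaussian_le :
    ∫⁻ x, ENNReal.ofReal (Real.exp (x ^ 2 / 4)) ∂gaussianReal 0 1 ≤ 2 := by
  rw [← ofReal_integral_eq_lintegral_ofReal integrable_exp_sq_gaussian
    (.of_forall fun x => Real.exp_nonneg _), integral_gaussianReal_eq_integral_smul one_ne_zero]
  simp only [gaussianPDFReal_smul_exp_sq]
  rw [integral_const_mul, integral_gaussian]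
  refine ENNReal.ofReal_le_of_le_toReal ?_
  have hpi := Real.pi_pos
  rw [ENNReal.toReal_ofNat, inv_mul_le_iff₀ (by positivity)]
  refine Real.sqrt_le_iff.2 ⟨by positivity, ?_⟩
  rw [mul_pow, Real.sq_sqrt (by positivity)]
  linarith

/-- Exponential moment of the squared norm of the projection of a sub-Gaussian vector onto the
span of an orthonormal family. -/
theorem IsSubGaussianVec.lintegral_exp_sum_sq_le {Ω : Type*} [MeasurableSpace Ω] {μ : Measure Ω}
    [IsProbabilityMeasure μ] {n : ℕ} {ξ : Ω → Vec n} {σ : ℝ} (h : IsSubGaussianVec μ ξ σ)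
    (hσ : 0 < σ) {k : ℕ} {u : Fin k → Vec n} (hu : Orthonormal ℝ u) :
    ∫⁻ ω, ENNReal.ofReal (Real.exp ((∑ i, inner ℝ (ξ ω) (u i) ^ 2) / (8 * σ ^ 2))) ∂μ
      ≤ 2 * 2 ^ k := by
  set γ : Measure (Fin k → ℝ) := Measure.pi fun _ => gaussianReal 0 1 with hγ
  -- Linearization: for fixed `e`, the Gaussian average over `g` of `exp ⟨e, v g⟩` is the
  -- exponential of the quadratic form. The scale `(2σ)⁻¹` turns `σ²‖v g‖²` into `∑ g_i²/4`, which
  -- is still exponentially integrable.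
  set v : (Fin k → ℝ) → Vec n := fun g => (2 * σ)⁻¹ • ∑ i, g i • u i with hv
  have hinner : ∀ e g, inner ℝ e (v g) = ∑ i, ((2 * σ)⁻¹ * inner ℝ e (u i)) * g i := by
    intro e g
    simp only [hv, inner_smul_right, inner_sum, Finset.mul_sum]
    exact Finset.sum_congr rfl fun i _ => by ring
  have hnorm : ∀ g, σ ^ 2 * ‖v g‖ ^ 2 = ∑ i, g i ^ 2 / 4 := by
    intro g
    have h1 : ‖∑ i, g i • u i‖ ^ 2 = ∑ i, g i ^ 2 := by
      rw [← real_inner_self_eq_norm_sq, hu.inner_sum]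
      exact Finset.sum_congr rfl fun i _ => by simp [sq]
    simp only [hv]
    rw [norm_smul, mul_pow, h1, ← Finset.sum_div, Real.norm_eq_abs, sq_abs]
    field_simp
    ring
  have hgauss : ∀ e : Vec n, ∫⁻ g, ENNReal.ofReal (Real.exp (inner ℝ e (v g))) ∂γ
      = ENNReal.ofReal (Real.exp ((∑ i, inner ℝ e (u i) ^ 2) / (8 * σ ^ 2))) := by
    intro e
    simp only [hinner, Real.exp_sum]
    rw [lintegral_ofReal_prod_eq (f := fun i x => Real.exp ((2 * σ)⁻¹ * inner ℝ e (u i) * x))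
      (fun i => integrable_exp_mul_gaussianReal _) (fun i x => Real.exp_nonneg _)]
    rw [Finset.sum_div, Real.exp_sum, ENNReal.ofReal_prod_of_nonneg fun i _ => Real.exp_nonneg _]
    refine Finset.prod_congr rfl fun i _ => ?_
    rw [← ofReal_integral_eq_lintegral_ofReal (integrable_exp_mul_gaussianReal _)
      (.of_forall fun x => Real.exp_nonneg _), integral_exp_mul_gaussian]
    congr 2
    field_simp
    ring
  have hmeas : AEMeasurable (Function.uncurry fun ω g =>
      ENNReal.ofReal (Real.exp (inner ℝ (ξ ω) (v g)))) (μ.prod γ) := by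
    have h1 : AEMeasurable (fun z : Ω × (Fin k → ℝ) => ξ z.1) (μ.prod γ) :=
      h.aemeasurable.comp_fst
    have h2 : Measurable (fun z : Ω × (Fin k → ℝ) => v z.2) := by fun_prop
    exact (Real.measurable_exp.comp_aemeasurable
      (h1.inner h2.aemeasurable)).ennreal_ofReal
  calc _ = ∫⁻ ω, ∫⁻ g, ENNReal.ofReal (Real.exp (inner ℝ (ξ ω) (v g))) ∂γ ∂μ := by
        simp only [hgauss]
    _ = ∫⁻ g, ∫⁻ ω, ENNReal.ofReal (Real.exp (inner ℝ (ξ ω) (v g))) ∂μ ∂γ :=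
        lintegral_lintegral_swap hmeas
    _ ≤ ∫⁻ g, 2 * ENNReal.ofReal (∏ i, Real.exp (g i ^ 2 / 4)) ∂γ := by
        refine lintegral_mono fun g => (h.lintegral_exp_inner_le hσ (v g)).trans_eq ?_
        rw [hnorm, Real.exp_sum]
    _ = 2 * ∏ _i : Fin k, ∫⁻ x, ENNReal.ofReal (Real.exp (x ^ 2 / 4)) ∂gaussianReal 0 1 := by
        rw [lintegral_const_mul' _ _ (by simp), lintegral_ofReal_prod_eq
          (f := fun _ x => Real.exp (x ^ 2 / 4)) (fun _ => integrable_exp_sq_gaussian)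
          (fun _ _ => Real.exp_nonneg _)]
    _ ≤ 2 * 2 ^ k := by
        gcongr
        refine (Finset.prod_le_prod' fun _ _ => lintegral_exp_sq_gaussian_le).trans_eq ?_
        simp

end SubGaussian

/-! ### The stochastic term -/

section Noise

variable {n p : ℕ} (X : Matrix (Fin n) (Fin p) ℝ)

/-- The span of the columns of `X` indexed by `S`. -/
noncomputable def columnSpan (S : Finset (Fin p)) : Submodule ℝ (Vec n) :=
  Submodule.span ℝ
    ((S.image fun j => designMap X (EuclideanSpace.single j 1) : Finset (Vec n)) : Set (Vec n))

/-- The squared norm of the projection of `e` onto the span of the columns indexed by `S`. -/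
noncomputable def projSq (S : Finset (Fin p)) (e : Vec n) : ℝ :=
  ∑ i, inner ℝ e (stdOrthonormalBasis ℝ (columnSpan X S) i : Vec n) ^ 2

theorem finrank_columnSpan_le (S : Finset (Fin p)) :
    Module.finrank ℝ (columnSpan X S) ≤ S.card :=
  (finrank_span_finset_le_card _).trans Finset.card_image_le

theorem designMap_mem_columnSpan {S : Finset (Fin p)} {h : Vec p} (hS : ∀ j, j ∉ S → h j = 0) :
    designMap X h ∈ columnSpan X S := by
  have hh : h = ∑ j ∈ S, h j • EuclideanSpace.single j (1 : ℝ) := by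
    ext i
    by_cases hi : i ∈ S
    · simp [hi, Pi.single_apply]
    · simp [hi, hS, Pi.single_apply]
  rw [hh, map_sum]
  refine Submodule.sum_mem _ fun j hj => ?_
  rw [map_smul]
  exact Submodule.smul_mem _ _ (Submodule.subset_span (Finset.mem_coe.2
    (Finset.mem_image_of_mem _ hj)))

/-- Completing the square in each coordinate of an orthonormal basis of the column span. -/
theorem inner_sub_sq_le_projSq {S : Finset (Fin p)} {w : Vec n} (hw : w ∈ columnSpan X S)
    (e : Vec n) {c : ℝ} (hc : 0 < c) :
    inner ℝ e w - c / 2 * ‖w‖ ^ 2 ≤ projSq X S e / (2 * c) := by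
  set b := stdOrthonormalBasis ℝ (columnSpan X S) with hb
  set x : columnSpan X S := ⟨w, hw⟩ with hx
  have h1 : w = ∑ i, inner ℝ (b i) x • (b i : Vec n) := by
    have := congrArg Subtype.val (b.sum_repr' x)
    simpa using this.symm
  have h2 : inner ℝ e w = ∑ i, inner ℝ (b i) x * inner ℝ e (b i : Vec n) := by
    conv_lhs => rw [h1]
    simp only [inner_sum, inner_smul_right]
  have h3 : ‖w‖ ^ 2 = ∑ i, inner ℝ (b i) x ^ 2 := by
    have := b.sum_sq_norm_inner_right x
    simpa [hx] using this.symm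
  rw [h2, h3, projSq, Finset.mul_sum, ← Finset.sum_sub_distrib, Finset.sum_div]
  refine Finset.sum_le_sum fun i _ => ?_
  rw [← hb]
  generalize inner ℝ (b i) x = s
  generalize inner ℝ e (b i : Vec n) = t
  have : t ^ 2 / (2 * c) - (s * t - c / 2 * s ^ 2) = (t - c * s) ^ 2 / (2 * c) := by
    field_simp; ring
  have : 0 ≤ (t - c * s) ^ 2 / (2 * c) := by positivity
  linarith

theorem measurable_projSq (S : Finset (Fin p)) : Measurable (projSq X S) := by
  unfold projSq
  fun_prop

theorem IsSubGaussianVec.lintegral_exp_projSq_le {Ω : Type*} [MeasurableSpace Ω] {μ : Measure Ω}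
    [IsProbabilityMeasure μ] {ξ : Ω → Vec n} {σ : ℝ} (h : IsSubGaussianVec μ ξ σ)
    (hσ : 0 < σ) (S : Finset (Fin p)) :
    ∫⁻ ω, ENNReal.ofReal (Real.exp (projSq X S (ξ ω) / (8 * σ ^ 2))) ∂μ ≤ 2 * 2 ^ S.card := by
  have hu : Orthonormal ℝ fun i => (stdOrthonormalBasis ℝ (columnSpan X S) i : Vec n) :=
    (stdOrthonormalBasis ℝ (columnSpan X S)).orthonormal.comp_linearIsometry
      (columnSpan X S).subtypeₗᵢ
  refine (h.lintegral_exp_sum_sq_le hσ hu).trans ?_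
  gcongr
  · norm_num
  · exact finrank_columnSpan_le X S

/-- An exponential majorant of the supremum of the penalized stochastic term. -/
noncomputable def noiseBound (σ m : ℝ) (e : Vec n) : ℝ :=
  ∑ S : Finset (Fin p), Real.exp (projSq X S e / (8 * σ ^ 2) - m * S.card)

theorem noiseBound_nonneg (σ m : ℝ) (e : Vec n) : 0 ≤ noiseBound X σ m e :=
  Finset.sum_nonneg fun _ _ => Real.exp_nonneg _

theorem measurable_noiseBound (σ m : ℝ) : Measurable (noiseBound X σ m) := by
  unfold noiseBound
  have := measurable_projSq X
  fun_prop

theorem IsSubGaussianVec.lintegral_noiseBound_le {Ω : Type*} [MeasurableSpace Ω] {μ : Measure Ω}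
    [IsProbabilityMeasure μ] {ξ : Ω → Vec n} {σ : ℝ} (h : IsSubGaussianVec μ ξ σ)
    (hσ : 0 < σ) {m : ℝ} (hm : p * Real.exp (-m) ≤ 1 / 2) :
    ∫⁻ ω, ENNReal.ofReal (noiseBound X σ m (ξ ω)) ∂μ ≤ ENNReal.ofReal (2 * Real.exp 1) := by
  have hmeas : ∀ S : Finset (Fin p), AEMeasurable (fun ω => ENNReal.ofReal
      (Real.exp (projSq X S (ξ ω) / (8 * σ ^ 2) - m * S.card))) μ := fun S =>
    (Real.measurable_exp.comp_aemeasurable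
      ((((measurable_projSq X S).comp_aemeasurable h.aemeasurable).div_const _).sub_const
        _)).ennreal_ofReal
  simp only [noiseBound, ENNReal.ofReal_sum_of_nonneg fun _ _ => Real.exp_nonneg _]
  rw [lintegral_finsetSum' _ fun S _ => hmeas S]
  calc _ ≤ ∑ S : Finset (Fin p), ENNReal.ofReal (2 * (2 * Real.exp (-m)) ^ S.card) := by
        refine Finset.sum_le_sum fun S _ => ?_
        calc _ = ∫⁻ ω, ENNReal.ofReal (Real.exp (projSq X S (ξ ω) / (8 * σ ^ 2)))
              * ENNReal.ofReal (Real.exp (-m) ^ S.card) ∂μ := by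
              refine lintegral_congr fun ω => ?_
              rw [← ENNReal.ofReal_mul (Real.exp_nonneg _), ← Real.exp_nat_mul, ← Real.exp_add]
              congr 2
              ring
          _ ≤ 2 * 2 ^ S.card * ENNReal.ofReal (Real.exp (-m) ^ S.card) := by
              rw [lintegral_mul_const' _ _ ENNReal.ofReal_ne_top]
              gcongr
              exact h.lintegral_exp_projSq_le X hσ S
          _ = _ := by
              rw [mul_pow, ← mul_assoc, ENNReal.ofReal_mul (by positivity),
                ENNReal.ofReal_mul (by positivity), ENNReal.ofReal_pow zero_le_two,
                ENNReal.ofReal_ofNat]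
    -- The sum over all supports is a binomial expansion.
    _ = ENNReal.ofReal (2 * (2 * Real.exp (-m) + 1) ^ p) := by
        rw [← ENNReal.ofReal_sum_of_nonneg fun _ _ => by positivity, ← Finset.mul_sum]
        have := Fintype.sum_pow_mul_eq_add_pow (Fin p) (2 * Real.exp (-m)) 1
        simp only [one_pow, mul_one, Fintype.card_fin] at this
        rw [this]
    _ ≤ _ := by
        apply ENNReal.ofReal_le_ofReal
        gcongr
        calc (2 * Real.exp (-m) + 1) ^ p ≤ Real.exp (2 * Real.exp (-m)) ^ p := by
              gcongr
              exact Real.add_one_le_exp _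
          _ = Real.exp (p * (2 * Real.exp (-m))) := (Real.exp_nat_mul _ _).symm
          _ ≤ Real.exp 1 := Real.exp_le_exp.2 (by linarith)

/-! ### Reduction of the hard-thresholding penalty to a cardinality penalty -/

theorem hardPen_nonneg {lam : ℝ} (t : ℝ) : 0 ≤ hardPen lam t := by
  unfold hardPen
  split_ifs with h
  · have := abs_nonneg t
    rw [← sq_abs t]
    nlinarith
  · positivity

theorem hardPen_zero {lam : ℝ} (hl : 0 ≤ lam) : hardPen lam 0 = 0 := by
  rcases hl.eq_or_lt with rfl | h <;> simp [hardPen, *]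

theorem hardPen_of_le {lam t : ℝ} (h : lam ≤ |t|) : hardPen lam t = lam ^ 2 / 2 :=
  if_neg (not_lt.2 h)

/-- The penalized stochastic term. -/
noncomputable def noiseObj (e : Vec n) (c ϑ ϱ lam : ℝ) (h : Vec p) : ℝ :=
  inner ℝ e (designMap X h) - c / 2 * ‖designMap X h‖ ^ 2 - ϑ * sepPen (hardPen lam) (ϱ • h)

theorem sepPen_add_single (P : ℝ → ℝ) (ϱ : ℝ) (h : Vec p) (j : Fin p) (x : ℝ) :
    sepPen P (ϱ • (h + x • EuclideanSpace.single j 1))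
      = P (ϱ * (h j + x)) + ∑ i ∈ Finset.univ.erase j, P (ϱ * h i) := by
  rw [sepPen, ← Finset.add_sum_erase _ _ (Finset.mem_univ j)]
  congr 1
  · simp [mul_add]
  · refine Finset.sum_congr rfl fun i hi => ?_
    simp [Finset.ne_of_mem_erase hi]

theorem norm_sq_segment {k : ℕ} (u w : Vec k) (t : ℝ) :
    ‖(1 - t) • u + t • w‖ ^ 2
      = (1 - t) * ‖u‖ ^ 2 + t * ‖w‖ ^ 2 - t * (1 - t) * ‖w - u‖ ^ 2 := by
  rw [norm_add_sq_real, norm_sub_sq_real, norm_smul, norm_smul, mul_pow, mul_pow, inner_smul_left,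
    inner_smul_right, real_inner_comm u w]
  simp only [Real.norm_eq_abs, sq_abs, conj_trivial]
  ring

/-- Along one coordinate the objective is convex on the range where the penalty is not constant,
so that it increases at one of the two end points. -/
theorem exists_coord_noiseObj_le (e : Vec n) {c ϑ ϱ lam : ℝ} (hc : 0 ≤ c) (hcϑ : c ≤ ϑ)
    (hϱ : 0 < ϱ) (hX : ‖designMap X‖ ≤ ϱ) (h : Vec p) (j : Fin p) :
    ∃ x : ℝ, noiseObj X e c ϑ ϱ lam h
        ≤ noiseObj X e c ϑ ϱ lam (h + x • EuclideanSpace.single j 1) ∧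
      (h j + x = 0 ∨ lam ≤ |ϱ * (h j + x)|) := by
  by_cases hj0 : h j = 0
  · exact ⟨0, by simp, by simp [hj0]⟩
  by_cases hjl : lam ≤ |ϱ * h j|
  · exact ⟨0, by simp, Or.inr (by rwa [add_zero])⟩
  push Not at hjl
  have hlam : 0 < lam := (abs_nonneg _).trans_lt hjl
  have hpos : 0 < |ϱ * h j| := abs_pos.2 (mul_ne_zero hϱ.ne' hj0)
  set θ := |ϱ * h j| / lam with hθ
  have hθ0 : 0 < θ := by positivity
  have hθ1 : θ < 1 := (div_lt_one hlam).2 hjl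
  set s := h j / θ with hs
  -- `h` lies on the segment from `h0` (coordinate `j` set to 0) to `h1` (coordinate `j` enlarged,
  -- with its sign, until `|ϱ s| = lam`), at parameter `θ`.
  have hθs : θ * s = h j := by rw [hs]; field_simp
  have habs : |ϱ * s| = lam := by
    rw [hs, mul_div_assoc', abs_div, abs_of_pos hθ0, hθ]
    field_simp
  set h0 := h + (-h j) • EuclideanSpace.single j (1 : ℝ) with hh0
  set h1 := h + (s - h j) • EuclideanSpace.single j (1 : ℝ) with hh1
  have hcomb : h = (1 - θ) • h0 + θ • h1 := by
    rw [hh0, hh1]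
    have : (1 - θ) * (-h j) + θ * (s - h j) = 0 := by linear_combination hθs
    rw [smul_add, smul_add, smul_smul, smul_smul, add_add_add_comm, ← add_smul, ← add_smul, this]
    simp
  have hX01 : ‖designMap X h1 - designMap X h0‖ ^ 2 ≤ lam ^ 2 := by
    have : h1 - h0 = s • EuclideanSpace.single j (1 : ℝ) := by
      rw [hh0, hh1, add_sub_add_left_eq_sub, ← sub_smul]
      congr 1
      ring
    rw [← map_sub, this, ← habs]
    refine pow_le_pow_left₀ (norm_nonneg _) ?_ 2
    refine ((designMap X).le_opNorm _).trans ?_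
    rw [norm_smul, abs_mul, abs_of_pos hϱ]
    simp only [PiLp.norm_single, norm_one, mul_one, Real.norm_eq_abs]
    gcongr
  have hl : designMap X h = (1 - θ) • designMap X h0 + θ • designMap X h1 := by
    conv_lhs => rw [hcomb]
    simp only [map_add, map_smul]
  have key : noiseObj X e c ϑ ϱ lam h
      ≤ (1 - θ) * noiseObj X e c ϑ ϱ lam h0 + θ * noiseObj X e c ϑ ϱ lam h1 := by
    have hp0 := sepPen_add_single (hardPen lam) ϱ h j (-h j)
    have hp1 := sepPen_add_single (hardPen lam) ϱ h j (s - h j)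
    have hp := sepPen_add_single (hardPen lam) ϱ h j 0
    rw [add_neg_cancel, mul_zero, hardPen_zero hlam.le] at hp0
    rw [add_sub_cancel, hardPen_of_le habs.ge] at hp1
    rw [zero_smul, add_zero, add_zero] at hp
    have hpj : hardPen lam (ϱ * h j) = -(θ * lam) ^ 2 / 2 + lam * (θ * lam) := by
      have : θ * lam = |ϱ * h j| := by rw [hθ]; field_simp
      rw [hardPen, if_pos hjl, this, sq_abs]
    rw [← hh0] at hp0
    rw [← hh1] at hp1
    have hin : inner ℝ e (designMap X h)
        = (1 - θ) * inner ℝ e (designMap X h0) + θ * inner ℝ e (designMap X h1) := by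
      rw [hl, inner_add_right, inner_smul_right, inner_smul_right]
    have hsq := norm_sq_segment (designMap X h0) (designMap X h1) θ
    rw [← hl] at hsq
    simp only [noiseObj]
    rw [hp0, hp1, hp, hpj, hin, hsq]
    have hθθ : 0 ≤ θ * (1 - θ) := mul_nonneg hθ0.le (by linarith)
    -- Below `lam`, `hardPen` exceeds its chord by `θ(1-θ)lam²/2`; multiplied by `ϑ`, this outweighs
    -- the concavity of `-(c/2)‖X·‖²`.
    have h5 : c * ‖designMap X h1 - designMap X h0‖ ^ 2 ≤ ϑ * lam ^ 2 :=
      mul_le_mul hcϑ hX01 (sq_nonneg _) (hc.trans hcϑ)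
    have h6 := mul_le_mul_of_nonneg_left h5 hθθ
    linarith
  by_cases hle : noiseObj X e c ϑ ϱ lam h ≤ noiseObj X e c ϑ ϱ lam h0
  · exact ⟨-h j, hle, by simp⟩
  · refine ⟨s - h j, ?_, Or.inr (by rw [add_sub_cancel, habs])⟩
    push Not at hle
    by_contra! hlt
    nlinarith

/-- Coordinates are treated one at a time; a move along one leaves those already treated unchanged.
-/
theorem exists_sparse_noiseObj_le (e : Vec n) {c ϑ ϱ lam : ℝ} (hc : 0 ≤ c) (hcϑ : c ≤ ϑ)
    (hϱ : 0 < ϱ) (hX : ‖designMap X‖ ≤ ϱ) (h : Vec p) (T : Finset (Fin p)) :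
    ∃ h' : Vec p, noiseObj X e c ϑ ϱ lam h ≤ noiseObj X e c ϑ ϱ lam h' ∧
      ∀ j ∈ T, h' j = 0 ∨ lam ≤ |ϱ * h' j| := by
  induction T using Finset.induction_on with
  | empty => exact ⟨h, le_rfl, by simp⟩
  | insert j T _ ih =>
    obtain ⟨h', hle, hT⟩ := ih
    obtain ⟨x, hx, hj⟩ := exists_coord_noiseObj_le X e (lam := lam) hc hcϑ hϱ hX h' j
    refine ⟨_, hle.trans hx, fun i hi => ?_⟩
    by_cases hij : i = j
    · subst hij; simpa using hj
    · simpa [hij] using hT i (Finset.mem_of_mem_insert_of_ne hi hij)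

/-- The right-hand side does not depend on `h`, so it applies to the data-dependent `h = b - β`.
Each support contributes `4σ²/c` times an exponent of `noiseBound`, and `x ≤ exp x` followed by
summation replaces the maximum over supports. -/
theorem noiseObj_le_noiseBound (e : Vec n) {c ϑ ϱ lam σ : ℝ} (hσ : 0 < σ) (hc : 0 < c)
    (hcϑ : c ≤ ϑ) (hl : 0 ≤ lam) (hX : ‖designMap X‖ ≤ ϱ) (h : Vec p) :
    noiseObj X e c ϑ ϱ lam h
      ≤ 4 * σ ^ 2 / c * noiseBound X σ (ϑ * lam ^ 2 * c / (8 * σ ^ 2)) e := by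
  -- If `ϱ = 0` then `X = 0`, and the rescaling by `ϱ` is unavailable but not needed.
  rcases ((norm_nonneg _).trans hX).eq_or_lt with hϱ | hϱ
  · have hX0 : designMap X h = 0 := by
      have := (designMap X).le_opNorm h
      have hz : ‖designMap X‖ = 0 := le_antisymm (hX.trans_eq hϱ.symm) (norm_nonneg _)
      rw [hz, zero_mul] at this
      exact norm_le_zero_iff.1 this
    have h1 : noiseObj X e c ϑ ϱ lam h ≤ 0 := by
      have : 0 ≤ sepPen (hardPen lam) (ϱ • h) := Finset.sum_nonneg fun _ _ => hardPen_nonneg _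
      simp only [noiseObj, hX0, inner_zero_right, norm_zero]
      nlinarith
    exact h1.trans (mul_nonneg (by positivity) (noiseBound_nonneg X _ _ _))
  obtain ⟨h', hle, hsp⟩ := exists_sparse_noiseObj_le X e (lam := lam) hc.le hcϑ hϱ hX h Finset.univ
  refine hle.trans ?_
  set S : Finset (Fin p) := Finset.univ.filter fun j => h' j ≠ 0 with hS
  have hpen : sepPen (hardPen lam) (ϱ • h') = S.card * (lam ^ 2 / 2) := by
    rw [sepPen, hS, Finset.card_filter, Nat.cast_sum, Finset.sum_mul]
    refine Finset.sum_congr rfl fun j _ => ?_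
    by_cases hj : h' j = 0
    · simp [hj, hardPen_zero hl]
    · simpa [hj] using hardPen_of_le ((hsp j (Finset.mem_univ j)).resolve_left hj)
  have hproj := inner_sub_sq_le_projSq X
    (designMap_mem_columnSpan X (S := S) (h := h') fun j hj => by simpa [hS] using hj) e hc
  have hσc : 0 < 4 * σ ^ 2 / c := by positivity
  calc noiseObj X e c ϑ ϱ lam h'
      ≤ projSq X S e / (2 * c) - ϑ * (S.card * (lam ^ 2 / 2)) := by
        rw [noiseObj, hpen]; linarith
    _ = 4 * σ ^ 2 / c * (projSq X S e / (8 * σ ^ 2)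
          - ϑ * lam ^ 2 * c / (8 * σ ^ 2) * S.card) := by
        field_simp
        ring
    _ ≤ 4 * σ ^ 2 / c * Real.exp (projSq X S e / (8 * σ ^ 2)
          - ϑ * lam ^ 2 * c / (8 * σ ^ 2) * S.card) := by
        gcongr
        linarith [Real.add_one_le_exp (projSq X S e / (8 * σ ^ 2)
          - ϑ * lam ^ 2 * c / (8 * σ ^ 2) * S.card)]
    _ ≤ _ := by
        gcongr
        exact Finset.single_le_sum (f := fun S : Finset (Fin p) => Real.exp
          (projSq X S e / (8 * σ ^ 2) - ϑ * lam ^ 2 * c / (8 * σ ^ 2) * S.card))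
          (fun _ _ => Real.exp_nonneg _) (Finset.mem_univ S)

end Noise

/-! ### One-sided directional derivatives and fixed points of the surrogate -/

section FixedPoint

theorem DirDifferentiable.hasDerivWithinAt {k : ℕ} {ψ : Vec k → ℝ} (h : DirDifferentiable ψ)
    (x v : Vec k) :
    HasDerivWithinAt (fun t : ℝ => ψ (x + t • v)) (dirDeriv ψ x v) (Set.Ici 0) 0 :=
  (h x v).hasDerivWithinAt

theorem dirDeriv_zero {k : ℕ} (ψ : Vec k → ℝ) (x : Vec k) : dirDeriv ψ x 0 = 0 := by
  simp [dirDeriv]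

theorem DirDifferentiable.dirDeriv_smul {k : ℕ} {ψ : Vec k → ℝ} (h : DirDifferentiable ψ)
    (x v : Vec k) {c : ℝ} (hc : 0 ≤ c) : dirDeriv ψ x (c • v) = c * dirDeriv ψ x v := by
  have h1 : HasDerivWithinAt (fun t : ℝ => t * c) c (Set.Ici 0) 0 := by
    simpa using (hasDerivWithinAt_id (0 : ℝ) (Set.Ici 0)).mul_const c
  have h2 : HasDerivWithinAt (fun t : ℝ => ψ (x + t • v)) (dirDeriv ψ x v) (Set.Ici 0) (0 * c) := by
    rw [zero_mul]
    exact h.hasDerivWithinAt x v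
  have h3 := HasDerivWithinAt.comp (0 : ℝ) h2 h1 fun t ht => mul_nonneg ht hc
  have h4 := h3.derivWithin (uniqueDiffOn_Ici (0 : ℝ) 0 Set.self_mem_Ici)
  rw [mul_comm, ← h4, dirDeriv]
  congr 1
  ext t
  simp [smul_smul]

theorem dirDeriv_eq_inner_gradient {k : ℕ} {f : Vec k → ℝ} {x : Vec k}
    (hf : DifferentiableAt ℝ f x) (v : Vec k) : dirDeriv f x v = inner ℝ (gradient f x) v := by
  have h1 : HasDerivAt (fun t : ℝ => x + t • v) v 0 := by
    simpa using ((hasDerivAt_id (0 : ℝ)).smul_const v).const_add x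
  have h2 : HasFDerivAt f (fderiv ℝ f x) (x + (0 : ℝ) • v) := by
    simpa using hf.hasFDerivAt
  have h3 := h2.comp_hasDerivAt (0 : ℝ) h1
  rw [gradient, InnerProductSpace.toDual_symm_apply]
  exact h3.hasDerivWithinAt.derivWithin (uniqueDiffOn_Ici (0 : ℝ) 0 Set.self_mem_Ici)

variable {n p : ℕ} {l₀ : Vec n → ℝ} {X : Matrix (Fin n) (Fin p) ℝ}

theorem dirDeriv_lossOf (x v : Vec p) :
    dirDeriv (lossOf l₀ X) x v = dirDeriv l₀ (designMap X x) (designMap X v) := by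
  simp only [dirDeriv, lossOf, map_add, map_smul]

theorem gbf_lossOf (x y : Vec p) :
    gbf (lossOf l₀ X) x y = gbf l₀ (designMap X x) (designMap X y) := by
  simp only [gbf, dirDeriv_lossOf, map_sub, lossOf]

theorem DirDifferentiable.lossOf (h : DirDifferentiable l₀) :
    DirDifferentiable (lossOf l₀ X) := fun x v => by
  simpa only [OracleIneq.lossOf, map_add, map_smul] using h (designMap X x) (designMap X v)

/-- First-order condition at a fixed point of a surrogate whose penalty is convex up to a
quadratic term: the Bregman function of `ψ` plays no role. -/
theorem firstOrder_of_isFixedPt {l ψ P : Vec p → ℝ} (hl : DirDifferentiable l)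
    (hψ : DirDifferentiable ψ) {b β : Vec p} {M : ℝ}
    (hfix : IsFixedPt (fun x y => l x + P x + gbf ψ x y) b)
    (hP : ∀ t : ℝ, 0 ≤ t → t ≤ 1 →
      P (b + t • (β - b)) ≤ (1 - t) * P b + t * P β + t * (1 - t) * M) :
    0 ≤ dirDeriv l b (β - b) + (P β - P b) + M := by
  set v := β - b with hv
  -- Replacing `P` along the segment by its quadratic upper bound gives `F t ≥ F 0`, without
  -- differentiating `P`. The right derivative of `F` at 0 is the claimed quantity, the two
  -- contributions of `ψ` cancelling.
  set F : ℝ → ℝ := fun t => l (b + t • v) + ψ (b + t • v) + t * (P β - P b - dirDeriv ψ b v)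
    + t * (1 - t) * M with hF
  have hid := hasDerivWithinAt_id (0 : ℝ) (Set.Ici 0)
  have hder : HasDerivWithinAt F (dirDeriv l b v + (P β - P b) + M) (Set.Ici 0) 0 := by
    have h1 := (((hl.hasDerivWithinAt b v).add (hψ.hasDerivWithinAt b v)).add
      (hid.mul_const (P β - P b - dirDeriv ψ b v))).add
      ((hid.mul ((hasDerivWithinAt_const (0 : ℝ) (Set.Ici 0) (1 : ℝ)).sub hid)).mul_const M)
    refine h1.congr_deriv ?_
    simp
  rw [← hasDerivWithinAt_Ioi_iff_Ici, hasDerivWithinAt_iff_tendsto_slope' Set.self_notMem_Ioi]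
    at hder
  refine ge_of_tendsto hder ?_
  filter_upwards [Ioc_mem_nhdsGT (zero_lt_one' ℝ)] with t ht
  have h1 := hfix (b + t • v)
  have h2 := hP t ht.1.le ht.2
  simp only [gbf, sub_self, dirDeriv_zero, add_sub_cancel_left, hψ.dirDeriv_smul b v ht.1.le] at h1
  rw [slope_def_field, sub_zero]
  refine div_nonneg ?_ ht.1.le
  simp only [hF, zero_smul, add_zero]
  linarith

theorem sepPen_thetaPen_segment_le {Θ : ℝ → ℝ → ℝ} {lam : ℝ} (hΘ : IsThresholding Θ)
    (hl : 0 ≤ lam) (ϱ : ℝ) (b β : Vec p) {t : ℝ} (ht0 : 0 ≤ t) (ht1 : t ≤ 1) :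
    sepPen (thetaPen Θ lam) (ϱ • (b + t • (β - b)))
      ≤ (1 - t) * sepPen (thetaPen Θ lam) (ϱ • b) + t * sepPen (thetaPen Θ lam) (ϱ • β)
        + t * (1 - t) * (ϱ ^ 2 * concavityNumber Θ lam * D2 β b) := by
  have hD : D2 β b = ∑ j, (b j - β j) ^ 2 / 2 := by
    rw [D2, EuclideanSpace.norm_sq_eq, Finset.sum_div]
    refine Finset.sum_congr rfl fun j _ => ?_
    rw [Real.norm_eq_abs, sq_abs, PiLp.sub_apply]
    ring
  rw [hD]
  simp only [sepPen, Finset.mul_sum, ← Finset.sum_add_distrib]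
  refine Finset.sum_le_sum fun j _ => ?_
  have := hΘ.thetaPen_segment_le hl (ϱ * b j) (ϱ * β j) ht0 ht1
  simp only [PiLp.smul_apply, PiLp.add_apply, PiLp.sub_apply, smul_eq_mul]
  rw [show ϱ * (b j + t * (β j - b j)) = (1 - t) * (ϱ * b j) + t * (ϱ * β j) by ring]
  refine this.trans_eq ?_
  ring

theorem sepPen_hardPen_neg {lam : ℝ} (h : Vec p) :
    sepPen (hardPen lam) (-h) = sepPen (hardPen lam) h := by
  simp [sepPen, hardPen]

/-- Differentiability at `Xβ*` makes the directional derivative there linear, so the first-order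
terms combine into a single noise term. -/
theorem gbf_lossOf_sub_eq (βs : Vec p) (hdiff : DifferentiableAt ℝ l₀ (designMap X βs))
    (b β : Vec p) :
    gbf (lossOf l₀ X) b βs - gbf (lossOf l₀ X) β βs
      = lossOf l₀ X b - lossOf l₀ X β
        + inner ℝ (effectiveNoise l₀ X βs) (designMap X (b - β)) := by
  have h1 : b - β = (b - βs) - (β - βs) := by abel
  rw [h1, map_sub, inner_sub_right]
  simp only [gbf, dirDeriv_lossOf, dirDeriv_eq_inner_gradient hdiff, effectiveNoise,
    inner_neg_left]
  ring

/-- The basic inequality satisfied by a fixed point of the surrogate. -/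
theorem gbf_le_of_isFixedPt {Θ : ℝ → ℝ → ℝ} {ψ : Vec p → ℝ} {ϱ lam q c δ ϑ K : ℝ}
    {β βs b : Vec p} (hl₀ : DirDifferentiable l₀)
    (hdiff : DifferentiableAt ℝ l₀ (designMap X βs)) (hΘ : IsThresholding Θ)
    (hψ : DirDifferentiable ψ) (hl : 0 ≤ lam) (hcδ : c ≤ δ)
    (hreg : RegularityCondition l₀ X Θ ϱ lam q δ ϑ K β)
    (hfix : IsFixedPt (surrogate l₀ X Θ ϱ lam ψ) b) :
    gbf (lossOf l₀ X) b βs ≤ gbf (lossOf l₀ X) β βs + q * gbf (lossOf l₀ X) β b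
      + K * lam ^ 2 * suppCard β
      + noiseObj X (effectiveNoise l₀ X βs) c ϑ ϱ lam (b - β) := by
  have h1 := firstOrder_of_isFixedPt (l := lossOf l₀ X)
    (P := fun x => sepPen (thetaPen Θ lam) (ϱ • x)) (β := β) (b := b) hl₀.lossOf hψ hfix
    fun t ht0 ht1 => sepPen_thetaPen_segment_le hΘ hl ϱ b β ht0 ht1
  -- At `γ = b` the concavity and penalty terms are those of `h1`; the part of `(1 + q) Δ(β,b)` with
  -- coefficient 1 supplies the loss difference in `h3`.
  have h2 := hreg b
  have h3 := gbf_lossOf_sub_eq (X := X) βs hdiff b β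
  have h4 : gbf (lossOf l₀ X) β b
      = lossOf l₀ X β - lossOf l₀ X b - dirDeriv (lossOf l₀ X) b (β - b) := rfl
  have h5 : sepPen (hardPen lam) (ϱ • (b - β)) = sepPen (hardPen lam) (ϱ • (β - b)) := by
    rw [← sepPen_hardPen_neg, ← smul_neg, neg_sub]
  have h6 : D2 (designMap X β) (designMap X b) = ‖designMap X (b - β)‖ ^ 2 / 2 := by
    rw [D2, map_sub, norm_sub_rev]
  have h7 := mul_le_mul_of_nonneg_right hcδ (sq_nonneg ‖designMap X (b - β)‖)
  rw [h6] at h2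
  rw [noiseObj, h5]
  linarith

end FixedPoint

/-! ### The curvature ratio -/

section Curvature

/-- In `EReal`, division by 0 or `±∞` gives 0. For finite nonzero `L`, `α = -∞` would make the
quotient `±∞` (if `r > 0`), which the hypotheses exclude. -/
theorem curvatureRatio_cases {α L : EReal} {r : ℝ} (hαL : α ≤ L) (hr : 0 ≤ r)
    (h0 : 0 ≤ α * (r : EReal) / L) (htop : α * (r : EReal) / L ≠ ⊤) :
    (α * (r : EReal) / L).toReal = 0 ∨ ∃ a l : ℝ, α = a ∧ L = l ∧ r ≠ 0 ∧ (0 < a ∨ l < 0) ∧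
      (α * (r : EReal) / L).toReal = a * r / l := by
  rcases hr.eq_or_lt with rfl | hr
  · left; simp
  induction L with
  | bot => left; simp
  | top => left; simp
  | coe l =>
    rcases lt_trichotomy l 0 with hl | rfl | hl
    · induction α with
      | bot =>
        rw [EReal.bot_mul_coe_of_pos hr, EReal.bot_div_of_neg_ne_bot (by exact_mod_cast hl)
          (by simp)] at htop
        exact absurd rfl htop
      | top => simp at hαL
      | coe a =>
        refine Or.inr ⟨a, l, rfl, rfl, hr.ne', Or.inr hl, ?_⟩
        norm_cast
    · left; simp
    · induction α with
      | bot =>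
        rw [EReal.bot_mul_coe_of_pos hr, EReal.bot_div_of_pos_ne_top (by exact_mod_cast hl)
          (by simp)] at h0
        simp at h0
      | top => simp at hαL
      | coe a =>
        have hc : (a : EReal) * (r : EReal) / (l : EReal) = ((a * r / l : ℝ) : EReal) := by
          norm_cast
        rw [hc] at h0 ⊢
        have ha : 0 ≤ a * r / l := by exact_mod_cast h0
        rcases ha.eq_or_lt with h | h
        · left; rw [← h]; simp
        · refine Or.inr ⟨a, l, rfl, rfl, hr.ne', Or.inl ?_, by simp⟩
          have h1 : 0 < a * r := by
            have := mul_pos h hl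
            rwa [div_mul_cancel₀ _ hl.ne'] at this
          exact pos_of_mul_pos_left h1 hr.le

/-- Weighted Cauchy–Schwarz with weights `(1-r)/2` and `(1+r)/2`, chosen so that `1 - 2r/(1+r)` is
the inverse of `1 + 2r/(1-r) = (1+r)/(1-r)`. -/
theorem sq_le_of_triangle {x y z r : ℝ} (hr0 : 0 ≤ r) (hr1 : r < 1) (hz : 0 ≤ z)
    (h : z ≤ x + y) : z ^ 2 ≤ 2 / (1 - r) * x ^ 2 + 2 / (1 + r) * y ^ 2 := by
  have h1 : 0 < 1 - r := by linarith
  have h2 : 0 < 1 + r := by linarith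
  have h3 : 2 / (1 - r) * x ^ 2 + 2 / (1 + r) * y ^ 2 - (x + y) ^ 2
      = ((1 + r) * x - (1 - r) * y) ^ 2 / ((1 - r) * (1 + r)) := by
    field_simp
    ring
  have h4 : 0 ≤ ((1 + r) * x - (1 - r) * y) ^ 2 / ((1 - r) * (1 + r)) := by positivity
  have h5 : z ^ 2 ≤ (x + y) ^ 2 := pow_le_pow_left₀ hz h 2
  linarith

theorem one_le_one_add_div_one_sub {r : ℝ} (hr0 : 0 ≤ r) (hr1 : r < 1) :
    1 ≤ (1 + r) / (1 - r) := by
  rw [le_div_iff₀ (by linarith)]; linarith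

/-- Positive curvature: `D`, `Y` and `B` stand for the Bregman functions of `(β, β*)`, `(b, β*)`
and `(β, b)`. -/
theorem le_of_pos_curvature {a l r D Y B x y z E : ℝ} (hr0 : 0 ≤ r) (hr1 : r < 1) (ha : 0 < a)
    (hl : 0 < l) (hz : 0 ≤ z) (htri : z ≤ x + y) (hD : a * x ^ 2 ≤ D) (hY : a * y ^ 2 ≤ Y)
    (hB : B ≤ l * z ^ 2) (hmain : Y ≤ D + a * r / l * B + E) :
    Y ≤ ((1 + r) / (1 - r)) ^ 2 * D + (1 + r) / (1 - r) * E := by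
  have h1 : 0 < 1 - r := by linarith
  have h2 : 0 < 1 + r := by linarith
  have h3 := sq_le_of_triangle hr0 hr1 hz htri
  have h4 : a * r / l * B ≤ r * (2 / (1 - r) * D + 2 / (1 + r) * Y) := by
    calc a * r / l * B ≤ a * r / l * (l * z ^ 2) := by gcongr
      _ = r * (a * z ^ 2) := by field_simp
      _ ≤ r * (a * (2 / (1 - r) * x ^ 2 + 2 / (1 + r) * y ^ 2)) := by gcongr
      _ = r * (2 / (1 - r) * (a * x ^ 2) + 2 / (1 + r) * (a * y ^ 2)) := by ring
      _ ≤ _ := by gcongr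
  have h5 : Y * ((1 - r) / (1 + r)) ≤ (1 + r) / (1 - r) * D + E := by
    have e1 : (1 - r) / (1 + r) = 1 - r * (2 / (1 + r)) := by field_simp; ring
    have e2 : (1 + r) / (1 - r) = 1 + r * (2 / (1 - r)) := by field_simp; ring
    rw [e1, e2]
    linarith
  have h6 := mul_le_mul_of_nonneg_left h5 (div_pos h2 h1).le
  have h7 : (1 + r) / (1 - r) * (Y * ((1 - r) / (1 + r))) = Y := by field_simp
  rw [h7] at h6
  linarith

/-- Negative curvature, in the only case that can occur: the reference point and the truth are
at distance zero. -/
theorem le_of_neg_curvature {a l r D Y B y z E : ℝ} (hr0 : 0 ≤ r) (hr1 : r < 1) (hal : a ≤ l)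
    (hl : l < 0) (hzy : z ^ 2 = y ^ 2) (hD : D = 0) (hY : a * y ^ 2 ≤ Y)
    (hB : B ≤ l * z ^ 2) (hE : 0 ≤ E) (hmain : Y ≤ D + a * r / l * B + E) :
    Y ≤ D + (1 + r) / (1 - r) * E := by
  have h1 : 0 < 1 - r := by linarith
  have hq : 0 ≤ a * r / l := div_nonneg_of_nonpos
    (mul_nonpos_of_nonpos_of_nonneg (hal.trans hl.le) hr0) hl.le
  have h4 : a * r / l * B ≤ r * Y := by
    calc a * r / l * B ≤ a * r / l * (l * z ^ 2) := by gcongr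
      _ = r * (a * y ^ 2) := by rw [hzy]; field_simp [hl.ne]
      _ ≤ r * Y := by gcongr
  rw [hD, zero_add, div_mul_eq_mul_div, le_div_iff₀ h1]
  nlinarith

end Curvature

/-! ### From almost sure bounds to expectations -/

/-- If the negative part has infinite integral, the expectation is `-∞` and the bound is trivial;
otherwise `Y` is integrable. -/
theorem extExpectation_le_of_ae_le {Ω : Type*} [MeasurableSpace Ω] {μ : Measure Ω} {Y B : Ω → ℝ}
    (hY : AEMeasurable Y μ) (hB : Integrable B μ) (h : ∀ᵐ ω ∂μ, Y ω ≤ B ω) :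
    ∫⁻ ω, ENNReal.ofReal (Y ω) ∂μ ≠ ⊤ ∧ extExpectation μ Y ≤ ((∫ ω, B ω ∂μ : ℝ) : EReal) := by
  have hpos : ∫⁻ ω, ENNReal.ofReal (Y ω) ∂μ ≠ ⊤ := by
    refine ((lintegral_mono_ae ?_).trans_lt hB.lintegral_lt_top).ne
    filter_upwards [h] with ω hω using ENNReal.ofReal_le_ofReal hω
  refine ⟨hpos, ?_⟩
  by_cases hneg : ∫⁻ ω, ENNReal.ofReal (-Y ω) ∂μ = ⊤
  · lift ∫⁻ ω, ENNReal.ofReal (Y ω) ∂μ to NNReal using hpos with y hy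
    rw [extExpectation, hneg, ← hy]
    simp
  · have hYi : Integrable Y μ := by
      refine ⟨hY.aestronglyMeasurable, ?_⟩
      rw [hasFiniteIntegral_iff_norm]
      calc ∫⁻ ω, ENNReal.ofReal ‖Y ω‖ ∂μ
          ≤ ∫⁻ ω, (ENNReal.ofReal (Y ω) + ENNReal.ofReal (-Y ω)) ∂μ := by
            refine lintegral_mono fun ω => ?_
            rcases le_total 0 (Y ω) with h | h
            · rw [Real.norm_of_nonneg h]; exact le_self_add
            · rw [Real.norm_of_nonpos h]; exact le_add_self
        _ = _ := lintegral_add_left' hY.ennreal_ofReal _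
        _ < ⊤ := ENNReal.add_lt_top.2 ⟨hpos.lt_top, lt_top_iff_ne_top.2 hneg⟩
    have h1 := integral_eq_lintegral_pos_part_sub_lintegral_neg_part hYi
    have h2 : extExpectation μ Y = ((∫ ω, Y ω ∂μ : ℝ) : EReal) := by
      rw [h1, extExpectation, EReal.coe_sub, EReal.coe_ennreal_toReal hpos,
        EReal.coe_ennreal_toReal hneg]
    rw [h2]
    exact_mod_cast integral_mono_ae hYi hB h

/-- Absorbs the Bregman function of `(β, b)` by means of the curvature of the loss. -/
theorem exists_ae_le_of_curvature {Ω : Type*} [MeasurableSpace Ω] {μ : Measure Ω} {n p : ℕ}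
    {X : Matrix (Fin n) (Fin p) ℝ} {l₀ : Ω → Vec n → ℝ} {βs β : Vec p} {b : Ω → Vec p}
    {α L : EReal} {r : ℝ} {E : Ω → ℝ} (hαL : α ≤ L) (hr0 : 0 ≤ r) (hr1 : r < 1)
    (h0 : 0 ≤ α * (r : EReal) / L) (htop : α * (r : EReal) / L ≠ ⊤)
    (hcurv : ∀ᵐ ω ∂μ, ∃ d : Vec n → Vec n → ℝ, IsPseudoMetric d ∧ ∀ η η' : Vec n,
          α * ((d η η' ^ 2 : ℝ) : EReal) ≤ ((gbf (l₀ ω) η η' : ℝ) : EReal) ∧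
          ((gbf (l₀ ω) η η' : ℝ) : EReal) ≤ L * ((d η η' ^ 2 : ℝ) : EReal))
    (hint : Integrable (fun ω => gbf (lossOf (l₀ ω) X) β βs) μ)
    (hED : r = 0 ∨ 0 ≤ ∫ ω, gbf (lossOf (l₀ ω) X) β βs ∂μ) (hE : ∀ ω, 0 ≤ E ω)
    (hmain : ∀ᵐ ω ∂μ, gbf (lossOf (l₀ ω) X) (b ω) βs ≤ gbf (lossOf (l₀ ω) X) β βs
      + (α * (r : EReal) / L).toReal * gbf (lossOf (l₀ ω) X) β (b ω) + E ω) :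
    ∃ c : ℝ, c * ∫ ω, gbf (lossOf (l₀ ω) X) β βs ∂μ
        ≤ ((1 + r) / (1 - r)) ^ 2 * ∫ ω, gbf (lossOf (l₀ ω) X) β βs ∂μ ∧
      ∀ᵐ ω ∂μ, gbf (lossOf (l₀ ω) X) (b ω) βs
        ≤ c * gbf (lossOf (l₀ ω) X) β βs + (1 + r) / (1 - r) * E ω := by
  have hκ := one_le_one_add_div_one_sub hr0 hr1
  -- Where the pointwise bound has `c = 1`, the larger leading constant is introduced only after
  -- integration, since `Δ(β,β*)` may be negative pointwise.
  have hfac : 1 * ∫ ω, gbf (lossOf (l₀ ω) X) β βs ∂μ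
      ≤ ((1 + r) / (1 - r)) ^ 2 * ∫ ω, gbf (lossOf (l₀ ω) X) β βs ∂μ := by
    rcases hED with rfl | hED
    · simp
    · exact mul_le_mul_of_nonneg_right (one_le_pow₀ hκ) hED
  rcases curvatureRatio_cases hαL hr0 h0 htop with hq | ⟨a, l, rfl, rfl, hr, hal, hq⟩
  · refine ⟨1, hfac, ?_⟩
    filter_upwards [hmain] with ω hω
    rw [hq] at hω
    nlinarith [mul_le_mul_of_nonneg_right hκ (hE ω)]
  · have hcurv' : ∀ᵐ ω ∂μ, ∃ d : Vec n → Vec n → ℝ, IsPseudoMetric d ∧ ∀ η η' : Vec n,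
        a * d η η' ^ 2 ≤ gbf (l₀ ω) η η' ∧ gbf (l₀ ω) η η' ≤ l * d η η' ^ 2 := by
      filter_upwards [hcurv] with ω ⟨d, hd, hω⟩
      exact ⟨d, hd, fun η η' => ⟨by exact_mod_cast (hω η η').1, by exact_mod_cast (hω η η').2⟩⟩
    rw [hq] at hmain
    have hal' : a ≤ l := by exact_mod_cast hαL
    rcases hal with ha | hl0
    · refine ⟨_, le_rfl, ?_⟩
      filter_upwards [hmain, hcurv'] with ω hω ⟨d, hd, hdω⟩
      simp only [gbf_lossOf] at hω ⊢
      exact le_of_pos_curvature hr0 hr1 ha (ha.trans_le hal') (hd.nonneg _ _)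
        (hd.triangle _ _ _) (hdω _ _).1 (hdω _ _).1 (hdω _ _).2 hω
    · refine ⟨1, hfac, ?_⟩
      -- With `L < 0`, `Δ(β,β*) ≤ 0` almost surely, while its mean is nonnegative; so it vanishes,
      -- which forces `d(Xβ, Xβ*) = 0`.
      have hD0 : ∀ᵐ ω ∂μ, gbf (lossOf (l₀ ω) X) β βs = 0 := by
        have hnonpos : ∀ᵐ ω ∂μ, 0 ≤ -gbf (lossOf (l₀ ω) X) β βs := by
          filter_upwards [hcurv'] with ω ⟨d, hd, hdω⟩
          rw [gbf_lossOf]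
          nlinarith [(hdω (designMap X β) (designMap X βs)).2,
            sq_nonneg (d (designMap X β) (designMap X βs))]
        have hz : ∫ ω, -gbf (lossOf (l₀ ω) X) β βs ∂μ = 0 := by
          refine le_antisymm ?_ (integral_nonneg_of_ae hnonpos)
          rw [integral_neg]
          exact neg_nonpos.2 (hED.resolve_left hr)
        filter_upwards [(integral_eq_zero_iff_of_nonneg_ae hnonpos hint.neg).1 hz] with ω hω
        simpa using hω
      filter_upwards [hmain, hcurv', hD0] with ω hω ⟨d, hd, hdω⟩ hDω
      simp only [gbf_lossOf] at hω hDω ⊢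
      have hd0 : d (designMap X β) (designMap X βs) = 0 := by
        have h1 := (hdω (designMap X β) (designMap X βs)).2
        rw [hDω] at h1
        exact pow_eq_zero_iff two_ne_zero |>.1
          (le_antisymm (nonpos_of_mul_nonneg_right h1 hl0) (sq_nonneg _))
      have hdd : d (designMap X β) (designMap X (b ω)) = d (designMap X (b ω)) (designMap X βs) := by
        have h1 := hd.triangle (designMap X β) (designMap X (b ω)) (designMap X βs)
        have h2 := hd.triangle (designMap X (b ω)) (designMap X βs) (designMap X β)
        rw [hd.symm (designMap X βs)] at h2
        rw [hd.symm (designMap X (b ω)) (designMap X β)] at h2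
        linarith
      rw [one_mul]
      exact le_of_neg_curvature hr0 hr1 hal' hl0 (by rw [hdd]) hDω (hdω _ _).1 (hdω _ _).2
        (hE ω) hω

theorem mul_exp_neg_le_half {p : ℕ} {m : ℝ} (hm : Real.log (Real.exp 1 * p) ≤ m) :
    p * Real.exp (-m) ≤ 1 / 2 := by
  rcases Nat.eq_zero_or_pos p with rfl | hp
  · simp
  have hp' : (0 : ℝ) < p := by exact_mod_cast hp
  have h1 : Real.exp 1 * p ≤ Real.exp m := by
    rw [← Real.exp_log (show 0 < Real.exp 1 * p by positivity)]
    exact Real.exp_le_exp.2 hm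
  have h2 : (2 : ℝ) ≤ Real.exp 1 := by linarith [Real.add_one_le_exp (1 : ℝ)]
  rw [Real.exp_neg, ← div_eq_mul_inv, div_le_div_iff₀ (Real.exp_pos _) two_pos]
  nlinarith

/-- For `p = 0` this rests on `Real.log 0 = 0`. -/
theorem log_exp_one_mul_natCast_nonneg (p : ℕ) : 0 ≤ Real.log (Real.exp 1 * p) := by
  rcases Nat.eq_zero_or_pos p with rfl | hp
  · simp
  have hp' : (1 : ℝ) ≤ p := by exact_mod_cast hp
  refine Real.log_nonneg ?_
  nlinarith [Real.add_one_le_exp (1 : ℝ)]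

end OracleIneq

/-! ### Calibration of the constants and the oracle inequality in expectation -/

open OracleIneq in
theorem theorem5 :
    ∃ A₀ C : ℝ, 0 < A₀ ∧ 0 < C ∧
      ∀ (Ω : Type*) [MeasurableSpace Ω] (μ : Measure Ω) [IsProbabilityMeasure μ]
        (n p : ℕ) (X : Matrix (Fin n) (Fin p) ℝ)
        -- the (data-dependent) loss, the truth, and the effective noise
        (l₀ : Ω → Vec n → ℝ) (βs : Vec p) (σ : ℝ),
        0 < σ →
        (∀ᵐ ω ∂μ, DirDifferentiable (l₀ ω)) →
        (∀ᵐ ω ∂μ, DifferentiableAt ℝ (l₀ ω) (designMap X βs)) →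
        IsSubGaussianVec μ (fun ω => effectiveNoise (l₀ ω) X βs) σ →
        ∫ ω, effectiveNoise (l₀ ω) X βs ∂μ = 0 →
      -- the thresholding, the scaling parameter, and the function defining the surrogate
      ∀ (Θ : ℝ → ℝ → ℝ) (ϱ : ℝ) (ψ : Ω → Vec p → ℝ),
        IsThresholding Θ →
        ‖designMap X‖ ≤ ϱ →
        (∀ᵐ ω ∂μ, DirDifferentiable (ψ ω)) →
      -- the curvature constants of the loss relative to a pseudo-metric
      ∀ (α L : EReal),
        α ≤ L →
        (∀ᵐ ω ∂μ, ∃ d : Vec n → Vec n → ℝ, IsPseudoMetric d ∧ ∀ η η' : Vec n,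
          α * ((d η η' ^ 2 : ℝ) : EReal) ≤ ((gbf (l₀ ω) η η' : ℝ) : EReal) ∧
          ((gbf (l₀ ω) η η' : ℝ) : EReal) ≤ L * ((d η η' ^ 2 : ℝ) : EReal)) →
      -- the reference point and the regularity condition
      ∀ (β : Vec p) (r δ ϑ K A lam : ℝ),
        0 ≤ r → r < 1 →
        0 ≤ α * (r : EReal) / L → α * (r : EReal) / L ≠ ⊤ →
        0 < δ → 0 < ϑ → 0 ≤ K → A₀ ≤ A →
        lam = A * σ * √(Real.log (Real.exp 1 * p)) / √(min δ (2 * ϑ) * ϑ) →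
        (∀ᵐ ω ∂μ, RegularityCondition (l₀ ω) X Θ ϱ lam (α * (r : EReal) / L).toReal δ ϑ K β) →
        Integrable (fun ω => gbf (lossOf (l₀ ω) X) β βs) μ →
        (r = 0 ∨ 0 ≤ ∫ ω, gbf (lossOf (l₀ ω) X) β βs ∂μ) →
      -- any choice of fixed points of the surrogate
      ∀ (βhat : Ω → Vec p),
        (∀ᵐ ω ∂μ, IsFixedPt (surrogate (l₀ ω) X Θ ϱ lam (ψ ω)) (βhat ω)) →
        AEMeasurable (fun ω => gbf (lossOf (l₀ ω) X) (βhat ω) βs) μ →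
        ∫⁻ ω, ENNReal.ofReal (gbf (lossOf (l₀ ω) X) (βhat ω) βs) ∂μ ≠ ⊤ ∧
        extExpectation μ (fun ω => gbf (lossOf (l₀ ω) X) (βhat ω) βs) ≤
          ((∫ ω, (((1 + r) / (1 - r)) ^ 2 * gbf (lossOf (l₀ ω) X) β βs
              + (1 + r) * K * A ^ 2 / ((1 - r) * min (2 * ϑ) δ * ϑ)
                * σ ^ 2 * (suppCard β : ℝ) * Real.log (Real.exp 1 * p)) ∂μ
            + C * (1 + r) / ((1 - r) * min (2 * ϑ) δ) * σ ^ 2 : ℝ) : EReal) := by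
  -- With `a = δ ∧ 2ϑ` and `c = δ ∧ ϑ ≥ a/2`: `A ≥ 4` gives `m = A² log(ep) c/(8a) ≥ log(ep)`, and
  -- the noise contributes at most `(4σ²/c)·2e ≤ 16eσ²/a`.
  refine ⟨4, 16 * Real.exp 1, by norm_num, by positivity, ?_⟩
  intro Ω _ μ _ n p X l₀ βs σ hσ hdir hdiff hsub _ Θ ϱ ψ hΘ hϱ hψ α L hαL hcurv β r δ ϑ K A lam
    hr0 hr1 hq0 hqtop hδ hϑ hK hA hlam hreg hint hED βhat hfix hY
  have hLg := log_exp_one_mul_natCast_nonneg p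
  set Lg := Real.log (Real.exp 1 * p)
  set a := min δ (2 * ϑ) with ha
  set c := min δ ϑ with hc
  have ha0 : 0 < a := lt_min hδ (by linarith)
  have hc0 : 0 < c := lt_min hδ hϑ
  have hac : a / 2 ≤ c := by
    refine le_min ?_ ?_
    · linarith [min_le_left δ (2 * ϑ)]
    · linarith [min_le_right δ (2 * ϑ)]
  have hA0 : 0 ≤ A := by linarith
  have hlam0 : 0 ≤ lam := by rw [hlam]; positivity
  have hlamsq : lam ^ 2 = A ^ 2 * σ ^ 2 * Lg / (a * ϑ) := by
    rw [hlam, div_pow, mul_pow, mul_pow, Real.sq_sqrt hLg, Real.sq_sqrt (by positivity)]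
  set m := ϑ * lam ^ 2 * c / (8 * σ ^ 2) with hm
  have hLgm : Lg ≤ m := by
    have h1 : m = A ^ 2 * Lg * c / (8 * a) := by
      rw [hm, hlamsq]; field_simp
    rw [h1, le_div_iff₀ (by positivity)]
    have h2 : 16 * a ≤ A ^ 2 * (2 * c) * 1 := by nlinarith [sq_nonneg (A - 4)]
    nlinarith
  set W : Ω → ℝ := fun ω => 4 * σ ^ 2 / c * noiseBound X σ m (effectiveNoise (l₀ ω) X βs) with hW
  have hW0 : ∀ ω, 0 ≤ W ω := fun ω => mul_nonneg (by positivity) (noiseBound_nonneg X _ _ _)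
  have hWm : AEMeasurable W μ :=
    ((measurable_noiseBound X σ m).comp_aemeasurable hsub.aemeasurable).const_mul _
  set V := 16 * Real.exp 1 / a * σ ^ 2 with hV
  have hWV : ∫⁻ ω, ENNReal.ofReal (W ω) ∂μ ≤ ENNReal.ofReal V := by
    have hc4 : 0 ≤ 4 * σ ^ 2 / c := by positivity
    simp only [hW, ENNReal.ofReal_mul hc4]
    rw [lintegral_const_mul' _ _ ENNReal.ofReal_ne_top]
    refine (mul_le_mul_right (hsub.lintegral_noiseBound_le X hσ (mul_exp_neg_le_half hLgm))
      _).trans ?_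
    rw [← ENNReal.ofReal_mul hc4]
    refine ENNReal.ofReal_le_ofReal ?_
    rw [hV, div_mul_eq_mul_div, div_mul_eq_mul_div, div_le_div_iff₀ hc0 ha0]
    have h1 : 0 < Real.exp 1 * σ ^ 2 := by positivity
    nlinarith
  have hWi : Integrable W μ :=
    (lintegral_ofReal_ne_top_iff_integrable hWm.aestronglyMeasurable (.of_forall hW0)).1
      (hWV.trans_lt ENNReal.ofReal_lt_top).ne
  have hWint : ∫ ω, W ω ∂μ ≤ V := by
    rw [integral_eq_lintegral_of_nonneg_ae (.of_forall hW0) hWm.aestronglyMeasurable]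
    exact ENNReal.toReal_le_of_le_ofReal (by positivity) hWV
  set κ := (1 + r) / (1 - r) with hκ
  have hκ1 : 1 ≤ κ := one_le_one_add_div_one_sub hr0 hr1
  set T := K * lam ^ 2 * (suppCard β : ℝ) with hT
  obtain ⟨f, hf, hbound⟩ := exists_ae_le_of_curvature (b := βhat) (E := fun ω => T + W ω) hαL hr0
    hr1 hq0 hqtop hcurv hint hED (fun ω => add_nonneg (by positivity) (hW0 ω)) (by
      filter_upwards [hdir, hdiff, hψ, hreg, hfix] with ω h1 h2 h3 h4 h5
      have h6 := gbf_le_of_isFixedPt (c := c) h1 h2 hΘ h3 hlam0 (min_le_left _ _) h4 h5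
      have h7 := noiseObj_le_noiseBound X (effectiveNoise (l₀ ω) X βs) hσ hc0 (min_le_right _ _)
        hlam0 hϱ (βhat ω - β)
      simp only [hW]
      linarith)
  have hfD := hint.const_mul f
  have hκW : Integrable (fun ω => κ * (T + W ω)) μ :=
    ((integrable_const T).add hWi).const_mul κ
  obtain ⟨hfin, hle⟩ := extExpectation_le_of_ae_le hY (hfD.add hκW) hbound
  refine ⟨hfin, hle.trans (EReal.coe_le_coe_iff.2 ?_)⟩
  have hI1 : ∫ ω, (f * gbf (lossOf (l₀ ω) X) β βs + κ * (T + W ω)) ∂μ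
      = f * (∫ ω, gbf (lossOf (l₀ ω) X) β βs ∂μ) + κ * (T + ∫ ω, W ω ∂μ) := by
    rw [integral_add hfD hκW, integral_const_mul, integral_const_mul]
    rw [integral_add (integrable_const T) hWi]
    simp
  have hI2 : ∀ x : ℝ, ∫ ω, (κ ^ 2 * gbf (lossOf (l₀ ω) X) β βs + x) ∂μ
      = κ ^ 2 * (∫ ω, gbf (lossOf (l₀ ω) X) β βs ∂μ) + x := by
    intro x
    rw [integral_add (hint.const_mul _) (integrable_const x), integral_const_mul]
    simp
  refine hI1.trans_le ?_
  rw [hI2, min_comm (2 * ϑ) δ, ← ha]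
  have h1r : (0 : ℝ) < 1 - r := by linarith
  have e1 : (1 + r) * K * A ^ 2 / ((1 - r) * a * ϑ) * σ ^ 2 * (suppCard β : ℝ) * Lg = κ * T := by
    rw [hT, hκ, hlamsq]
    field_simp
  have e2 : 16 * Real.exp 1 * (1 + r) / ((1 - r) * a) * σ ^ 2 = κ * V := by
    rw [hV, hκ]
    field_simp
  rw [e1, e2]
  nlinarith [mul_le_mul_of_nonneg_left hWint (zero_le_one.trans hκ1)]
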